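/- Let $F$ be a field of characteristic $0$, let $V$ be a $\mathbb Q$-vector space with a positive semidefinite symmetric bilinear form $(\cdot,\cdot)$, and put $\langle\alpha,\beta\rangle=2(\alpha,\beta)/(\beta,\beta)$, $\sigma_\alpha(\beta)=\beta-\langle\beta,\alpha\rangle\alpha$. Let $\mathfrak R\subset V$ be a locally extended affine root system: $\mathfrak R$ spans $V$; $(\alpha,\alpha)\neq 0$, $\langle\alpha,\beta\rangle\in\mathbb Z$ and $\sigma_\alpha(\beta)\in\mathfrak R$ for all $\alpha,\beta\in\mathfrak R$; and $\mathfrak R=\mathfrak R_1\cup\mathfrak R_2$ with $(\mathfrak R_1,\mathfrak R_2)=0$ implies $\mathfrak R_1=\emptyset$ or $\mathfrak R_2=\emptyset$. Let $Q$ be the subgroup of $V$ generated by $\mathfrak R$, let $V^0$ be the radical of the form, and let $\bar{\mathfrak R}$ be the image of $\mathfrak R$ in $\bar V=V/V^0$ (with the induced form). For a root system $\Delta$ put $\Delta^{\rm red}=\{\alpha\in\Delta\mid \frac12\alpha\notin\Delta\}$. Let $\Pi$ be a reflectable base of $\bar{\mathfrak R}$: a basis of $\bar V$ with $\Pi\subset\bar{\mathfrak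 R}$ such that every $\alpha\in\bar{\mathfrak R}^{\rm red}$ is of the form $\sigma_{\alpha_1}\cdots\sigma_{\alpha_k}(\alpha_{k+1})$ with $\alpha_1,\dots,\alpha_{k+1}\in\Pi$. For each $\alpha\in\Pi$ choose $\dot\alpha\in\mathfrak R$ with image $\alpha$, and let $V'=\operatorname{span}_{\mathbb Q}\{\dot\alpha\mid\alpha\in\Pi\}$ be the corresponding reflectable section. Put $\Delta=\{\mu\in V'\mid\bar\mu\in\bar{\mathfrak R}\}$, $S_\mu=\{v\in V^0\mid\mu+v\in\mathfrak R\}$ for $\mu\in\Delta$, and $G=\langle\bigcup_{\mu\in\Delta}S_\mu\rangle\subset V^0$. A Lie $\mathfrak R$-torus is a $Q$-graded Lie algebra $L=\bigoplus_{\xi\in Q}L_\xi$ over $F$, generated by $\bigcup_{\alpha\in\mathfrak R}L_\alpha$, with $\{\xi\in Q\mid L_\xi\neq0,\ (\xi,\xi)\neq0\}=\mathfrak R$, with $\dim L_\alpha=1$ for all $\alpha\in\mathfrak R$, and such that for all $\alpha\in\mathfrak R$ and $0\neq x\in L_\alpha$ there is $y\in L_{-\alpha}$ such that $[x,y]\in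 L_0$ acts on each $L_\xi$, $\xi\in Q$, as the scalar $\langle\xi,\alpha\rangle$. A normal (locally) Lie $G$-torus of type $\Delta$, where $\Delta$ is a locally finite irreducible root system, is a Lie algebra $L=\bigoplus_{\mu\in\Delta\cup\{0\},\,g\in G}L_\mu^g$ over $F$ such that (LT1) $[L_\mu^g,L_\nu^h]\subset L_{\mu+\nu}^{g+h}$ whenever $\mu,\nu,\mu+\nu\in\Delta\cup\{0\}$; (LT2) $L_0^g=\sum_{\mu\in\Delta,\,h\in G}[L_\mu^h,L_{-\mu}^{g-h}]$ for all $g\in G$; (LT3) for $\mu\in\Delta$, $g\in G$ and $0\ne x\in L_\mu^g$ there is $y\in L_{-\mu}^{-g}$ such that $[x,y]\in L_0^0$ acts on each $L_\nu^h$ ($\nu\in\Delta\cup\{0\}$, $h\in G$) as the scalar $\langle\nu,\mu\rangle$; (LT4) $G$ is generated by $\{g\mid L_\mu^g\neq0\text{ for some }\mu\in\Delta\cup\{0\}\}$; (LT5) $\dim L_\mu^g\le1$ for all $\mu\in\Delta$, $g\in G$; (LT6) $\dim L_\mu^0=1$ for all $\mu\in\Delta^{\rm red}$; (LT6)$'$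 $\bigoplus_{g}L_\mu^g\neq0$ for all $\mu\in\Delta$. **Theorem.** With these notations, for every reflectable section $V'$: 1. $V=V'\oplus V^0$, and every $\mu\in\Delta^{\rm red}$ lies in $\mathfrak R$. 2. Every $\xi\in Q$ can be written uniquely as $\xi=\mu+g$ with $\mu\in\langle\Delta\rangle$ and $g\in G$; and if $L=\bigoplus_{\xi\in Q}L_\xi$ is a Lie $\mathfrak R$-torus then $\Delta$ is a locally finite irreducible root system in $V'$, and $L$, with the subspaces $L_\mu^g:=L_{\mu+g}$ if $\mu+g\in Q$ and $L_\mu^g:=0$ otherwise ($\mu\in\Delta\cup\{0\}$, $g\in G$), is a normal Lie $G$-torus of type $\Delta$. -/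

import Mathlib

namespace LieTori

noncomputable section

/-! ### Root systems described by a symmetric bilinear form over `ℚ` -/

section RootSystems

variable {V : Type*} [AddCommGroup V] [Module ℚ V]

/-- `⟨α, β⟩ = 2 (α, β) / (β, β)`. -/
def cartan (B : LinearMap.BilinForm ℚ V) (α β : V) : ℚ := 2 * B α β / B β β

/-- `σ_α(β) = β - ⟨β, α⟩ α`. -/
def reflect (B : LinearMap.BilinForm ℚ V) (α β : V) : V := β - cartan B β α • α

/-- `R = R₁ ∪ R₂` with `(R₁, R₂) = 0` forces `R₁ = ∅` or `R₂ = ∅`. -/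
def IsIrreducibleSet (B : LinearMap.BilinForm ℚ V) (R : Set V) : Prop :=
  ∀ R₁ R₂ : Set V, R = R₁ ∪ R₂ → (∀ x ∈ R₁, ∀ y ∈ R₂, B x y = 0) → R₁ = ∅ ∨ R₂ = ∅

/-- `(R, V)` is a locally extended affine root system (LEARS) with respect to the positive
semidefinite symmetric form `B`. -/
structure IsLEARS (B : LinearMap.BilinForm ℚ V) (R : Set V) : Prop where
  symm : B.IsSymm
  nonneg : ∀ x, 0 ≤ B x x
  anisotropic : ∀ α ∈ R, B α α ≠ 0
  span_eq_top : Submodule.span ℚ R = ⊤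
  integral : ∀ α ∈ R, ∀ β ∈ R, ∃ n : ℤ, cartan B α β = n
  reflect_mem : ∀ α ∈ R, ∀ β ∈ R, reflect B α β ∈ R
  irreducible : IsIrreducibleSet B R

/-- `(Δ, E)` is a locally finite irreducible root system, with `B` a positive definite invariant
form through which the Cartan integers and the reflections are expressed. -/
structure IsLocallyFiniteIrreducibleRootSystem (B : LinearMap.BilinForm ℚ V) (Δ : Set V) :
    Prop where
  symm : B.IsSymm
  posDef : ∀ x, x ≠ 0 → 0 < B x x
  zero_notMem : (0 : V) ∉ Δ
  span_eq_top : Submodule.span ℚ Δ = ⊤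
  locallyFinite : ∀ W : Submodule ℚ V, FiniteDimensional ℚ W → (Δ ∩ (W : Set V)).Finite
  integral : ∀ α ∈ Δ, ∀ β ∈ Δ, ∃ n : ℤ, cartan B α β = n
  reflect_mem : ∀ α ∈ Δ, ∀ β ∈ Δ, reflect B α β ∈ Δ
  irreducible : IsIrreducibleSet B Δ

/-- `Δ^red = {α ∈ Δ | α / 2 ∉ Δ}`. -/
def redPart (Δ : Set V) : Set V := {α | α ∈ Δ ∧ (1 / 2 : ℚ) • α ∉ Δ}

/-- `Π` is a reflectable base of `Δ`: a basis of the space, contained in `Δ`, such that every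
`α ∈ Δ^red` is `σ_{α₁} ⋯ σ_{αₖ} (α_{k+1})` for some `α₁, …, α_{k+1} ∈ Π`. -/
structure IsReflectableBase (B : LinearMap.BilinForm ℚ V) (Δ P : Set V) : Prop where
  subset : P ⊆ Δ
  linearIndependent : LinearIndependent ℚ ((↑) : P → V)
  span_eq_top : Submodule.span ℚ P = ⊤
  exists_reflect : ∀ α ∈ redPart Δ, ∃ l : List V, (∀ a ∈ l, a ∈ P) ∧
    ∃ β ∈ P, α = l.foldr (reflect B) β

/-- The radical `V⁰ = {x | (x, y) = 0 for all y}`. -/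
abbrev radical (B : LinearMap.BilinForm ℚ V) : Submodule ℚ V := LinearMap.ker B

/-- The form induced by `B` on `V ⧸ V⁰`. -/
def inducedForm (B : LinearMap.BilinForm ℚ V) (hB : B.IsSymm) :
    LinearMap.BilinForm ℚ (V ⧸ radical B) :=
  LinearMap.liftQ₂ (radical B) (radical B) B le_rfl (by
    intro x hx
    rw [LinearMap.mem_ker] at hx ⊢
    ext y
    rw [LinearMap.flip_apply, hB.eq y x, hx])

theorem inducedForm_mk (B : LinearMap.BilinForm ℚ V) (hB : B.IsSymm) (x y : V) :
    inducedForm B hB ((radical B).mkQ x) ((radical B).mkQ y) = B x y := rfl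

/-- The image `R̄` of `R` in `V ⧸ V⁰`. -/
def imageBar (B : LinearMap.BilinForm ℚ V) (R : Set V) : Set (V ⧸ radical B) :=
  (radical B).mkQ '' R

/-- `V'` is a reflectable section: the span of lifts `dot α ∈ R` of the members `α` of some
reflectable base `Π` of `R̄`. -/
def IsReflectableSection (B : LinearMap.BilinForm ℚ V) (hB : B.IsSymm) (R : Set V)
    (V' : Submodule ℚ V) : Prop :=
  ∃ (P : Set (V ⧸ radical B)) (dot : V ⧸ radical B → V),
    IsReflectableBase (inducedForm B hB) (imageBar B R) P ∧
    (∀ α ∈ P, dot α ∈ R ∧ (radical B).mkQ (dot α) = α) ∧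
    V' = Submodule.span ℚ (dot '' P)

/-- `Δ = {α ∈ V' | ᾱ ∈ R̄}`. -/
def sectionRoots (B : LinearMap.BilinForm ℚ V) (R : Set V) (V' : Submodule ℚ V) : Set V' :=
  {α | (radical B).mkQ (α : V) ∈ imageBar B R}

/-- `S_α = {v ∈ V⁰ | α + v ∈ R}`. -/
def isotropicShifts (B : LinearMap.BilinForm ℚ V) (R : Set V) (α : V) : Set V :=
  {v | v ∈ radical B ∧ α + v ∈ R}

/-- The subgroup `G` of `V` generated by the union of the `S_α`, `α ∈ Δ`. -/
def sectionGroup (B : LinearMap.BilinForm ℚ V) (R : Set V) (V' : Submodule ℚ V) :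
    AddSubgroup V :=
  AddSubgroup.closure (⋃ α ∈ sectionRoots B R V', isotropicShifts B R (α : V))

/-- The root lattice `Q`, the subgroup of `V` generated by `R`. -/
abbrev rootLattice (R : Set V) : AddSubgroup V := AddSubgroup.closure R

end RootSystems

/-! ### Lie tori -/

section Tori

variable {F : Type*} [Field F] {L : Type*} [LieRing L] [LieAlgebra F L]

open Classical in
/-- The family `𝓖 = (L_ξ)_{ξ ∈ Q}` of subspaces makes `L` a Lie `R`-torus. -/
structure IsLieRTorus {V : Type*} [AddCommGroup V] [Module ℚ V]
    (B : LinearMap.BilinForm ℚ V) (R : Set V)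
    (𝓖 : rootLattice R → Submodule F L) : Prop where
  isInternal : DirectSum.IsInternal 𝓖
  lie_mem : ∀ ξ η : rootLattice R, ∀ x ∈ 𝓖 ξ, ∀ y ∈ 𝓖 η, ⁅x, y⁆ ∈ 𝓖 (ξ + η)
  generated : LieSubalgebra.lieSpan F L
    (⋃ ξ ∈ {ξ : rootLattice R | (ξ : V) ∈ R}, (𝓖 ξ : Set L)) = ⊤
  /-- `(supp L)^× = R`. -/
  supp_eq : {v : V | ∃ ξ : rootLattice R, (ξ : V) = v ∧ 𝓖 ξ ≠ ⊥ ∧ B v v ≠ 0} = R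
  division : ∀ α : rootLattice R, (α : V) ∈ R → ∀ x ∈ 𝓖 α, x ≠ 0 → ∃ y ∈ 𝓖 (-α),
    ⁅x, y⁆ ∈ 𝓖 0 ∧
      ∀ ξ : rootLattice R, ∀ z ∈ 𝓖 ξ, ⁅⁅x, y⁆, z⁆ = ((cartan B (ξ : V) (α : V) : ℚ) : F) • z
  rank_eq_one : ∀ α : rootLattice R, (α : V) ∈ R → Module.rank F (𝓖 α) = 1

open Classical in
/-- The family `𝓛 = (L_μ^g)`, `μ ∈ Δ ∪ {0}`, `g ∈ G`, of subspaces makes `L` a general (locally)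
Lie `G`-torus of type `Δ`.  Only the values of `𝓛` at `μ ∈ Δ ∪ {0}` matter. -/
structure IsGeneralLieTorus {E : Type*} [AddCommGroup E] [Module ℚ E]
    (B : LinearMap.BilinForm ℚ E) (Δ : Set E) {G : Type*} [AddCommGroup G]
    (𝓛 : E → G → Submodule F L) : Prop where
  rootSystem : IsLocallyFiniteIrreducibleRootSystem B Δ
  isInternal : DirectSum.IsInternal
    (fun p : {μ : E // μ ∈ Δ ∪ {0}} × G => 𝓛 (p.1 : E) p.2)
  lie_mem : ∀ μ ∈ Δ ∪ {0}, ∀ ν ∈ Δ ∪ {0}, μ + ν ∈ Δ ∪ {0} → ∀ g h : G,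
    ∀ x ∈ 𝓛 μ g, ∀ y ∈ 𝓛 ν h, ⁅x, y⁆ ∈ 𝓛 (μ + ν) (g + h)
  zero_part : ∀ g : G, 𝓛 0 g = ⨆ μ ∈ Δ, ⨆ h : G,
    Submodule.span F {z : L | ∃ x ∈ 𝓛 μ h, ∃ y ∈ 𝓛 (-μ) (g - h), ⁅x, y⁆ = z}
  division : ∀ μ ∈ Δ, ∀ g : G, ∀ x ∈ 𝓛 μ g, x ≠ 0 → ∃ y ∈ 𝓛 (-μ) (-g),
    ⁅x, y⁆ ∈ 𝓛 0 0 ∧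
      ∀ ν ∈ Δ ∪ {0}, ∀ h : G, ∀ z ∈ 𝓛 ν h, ⁅⁅x, y⁆, z⁆ = ((cartan B ν μ : ℚ) : F) • z
  supp_generates : AddSubgroup.closure {g : G | ∃ μ ∈ Δ ∪ {0}, 𝓛 μ g ≠ ⊥} = ⊤
  rank_le_one : ∀ μ ∈ Δ, ∀ g : G, Module.rank F (𝓛 μ g) ≤ 1
  root_ne_bot : ∀ μ ∈ Δ, (⨆ g : G, 𝓛 μ g) ≠ ⊥

/-- A normal (locally) Lie `G`-torus of type `Δ`. -/
structure IsNormalLieTorus {E : Type*} [AddCommGroup E] [Module ℚ E]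
    (B : LinearMap.BilinForm ℚ E) (Δ : Set E) {G : Type*} [AddCommGroup G]
    (𝓛 : E → G → Submodule F L) : Prop extends IsGeneralLieTorus B Δ 𝓛 where
  rank_zero_eq_one : ∀ μ ∈ redPart Δ, Module.rank F (𝓛 μ 0) = 1

open Classical in
/-- The `Q`-grading read as a double grading along a section `V'`:
`L_μ^g = L_{μ+g}` if `μ + g ∈ Q`, and `L_μ^g = 0` otherwise. -/
def sectionGrading {V : Type*} [AddCommGroup V] [Module ℚ V]
    (B : LinearMap.BilinForm ℚ V) (R : Set V) (V' : Submodule ℚ V)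
    (𝓖 : rootLattice R → Submodule F L) (μ : V') (g : sectionGroup B R V') : Submodule F L :=
  if h : (μ : V) + (g : V) ∈ rootLattice R then 𝓖 ⟨(μ : V) + (g : V), h⟩ else ⊥

end Tori

end

end LieTori

namespace LieTori

/-! ### Semidefinite forms: the radical, Cartan integers and finiteness -/

section Forms

variable {V : Type*} [AddCommGroup V] [Module ℚ V] {B : LinearMap.BilinForm ℚ V}

/-! Lifts of a basis of `V ⧸ V⁰` span a complement `V'` of `V⁰`, and `V'` maps isomorphically onto
the quotient. Since `R ∩ V'` is stable under its own reflections, the words in simple reflections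
that produce the reduced roots of `R̄` lift to it, so every reduced root of `Δ` is a root
(`mem_of_mem_redPart_sectionRoots`). A non-reduced root of `Δ` is twice a reduced one, hence `Δ ⊆
Q`; each shift is a difference of a root and an element of `Δ`, hence also `G ⊆ Q`.

Thus `(μ, g) ↦ μ + g` embeds `(Δ ∪ {0}) × G` in `Q`. Its image contains the support of `L`: an
anisotropic degree of the support is a root, and an isotropic one lies in `V⁰`, so its
`V'`-component vanishes. The double grading is therefore the `Q`-grading reindexed, and division and
the dimension conditions carry over because vectors of the radical do not affect the form.

The substantial axiom is (LT2). It follows from generation by root spaces: replacing each isotropic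
component by the brackets of root spaces that land in it leaves an ideal containing the generators,
so nothing was lost (`IsLieRTorus.le_rootBrackets`). -/

theorem mem_radical_of_apply_self (hs : B.IsSymm) (hn : ∀ x, 0 ≤ B x x) {x : V}
    (hx : B x x = 0) : x ∈ radical B := by
  rw [LinearMap.mem_ker]
  ext y
  have h := LinearMap.BilinForm.apply_mul_apply_le_of_forall_zero_le B hn x y
  rw [hs.eq y x, hx, zero_mul] at h
  simpa using mul_self_eq_zero.mp (le_antisymm h (mul_self_nonneg _))

theorem apply_eq_zero_of_mem_radical {x : V} (hx : x ∈ radical B) (y : V) : B x y = 0 := by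
  rw [LinearMap.mem_ker.mp hx, LinearMap.zero_apply]

theorem apply_add_add_of_mem_radical (hs : B.IsSymm) {g h : V} (hg : g ∈ radical B)
    (hh : h ∈ radical B) (x y : V) : B (x + g) (y + h) = B x y := by
  have h1 := apply_eq_zero_of_mem_radical hg (y + h)
  have h2 := apply_eq_zero_of_mem_radical hh x
  rw [hs.eq] at h2
  rw [LinearMap.BilinForm.add_left, h1, LinearMap.BilinForm.add_right, h2, add_zero, add_zero]

theorem cartan_add_add_of_mem_radical (hs : B.IsSymm) {g h : V} (hg : g ∈ radical B)
    (hh : h ∈ radical B) (x y : V) : cartan B (x + g) (y + h) = cartan B x y := by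
  simp only [cartan, apply_add_add_of_mem_radical hs hg hh, apply_add_add_of_mem_radical hs hh hh]

theorem mkQ_reflect (hs : B.IsSymm) (x y : V) :
    (radical B).mkQ (reflect B x y) =
      reflect (inducedForm B hs) ((radical B).mkQ x) ((radical B).mkQ y) := by
  simp only [reflect, map_sub, map_smul, cartan, inducedForm_mk]

theorem foldr_reflect_mem {S : Set V} (hS : ∀ α ∈ S, ∀ β ∈ S, reflect B α β ∈ S) {β : V}
    (hβ : β ∈ S) (l : List V) (hl : ∀ a ∈ l, a ∈ S) : l.foldr (reflect B) β ∈ S := by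
  induction l with
  | nil => exact hβ
  | cons a l ih =>
    exact hS _ (hl a (by simp)) _ (ih fun b hb => hl b (by simp [hb]))

/-- Cauchy–Schwarz gives `0 ≤ m * n ≤ 4`, and `m`, `n` vanish together. -/
theorem abs_le_four_of_cartan_eq (hs : B.IsSymm) (hp : ∀ x, x ≠ 0 → 0 < B x x) {α β : V}
    (hα : α ≠ 0) (hβ : β ≠ 0) {m n : ℤ} (hm : cartan B α β = m) (hn : cartan B β α = n) :
    |m| ≤ 4 := by
  have ha := hp α hα
  have hb := hp β hβ
  have hnn : ∀ x, 0 ≤ B x x := fun x => by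
    rcases eq_or_ne x 0 with rfl | hx
    · simp
    · exact (hp x hx).le
  have hcs := LinearMap.BilinForm.apply_mul_apply_le_of_forall_zero_le B hnn α β
  rw [cartan] at hm hn
  rw [hs.eq β α] at hcs hn
  have hm' : 2 * B α β = m * B β β := by rw [← hm]; field_simp
  have hn' : 2 * B α β = n * B α α := by rw [← hn]; field_simp
  have hmul : ((m * n : ℤ) : ℚ) * (B α α * B β β) = 4 * (B α β * B α β) := by
    push_cast; linear_combination (-2 * B α β) * hm' - (m * B β β) * hn'
  have hle : m * n ≤ 4 := by
    have : ((m * n : ℤ) : ℚ) * (B α α * B β β) ≤ 4 * (B α α * B β β) := by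
      rw [hmul]; linarith
    exact_mod_cast le_of_mul_le_mul_right this (mul_pos ha hb)
  have hge : 0 ≤ m * n := by
    have : 0 * (B α α * B β β) ≤ ((m * n : ℤ) : ℚ) * (B α α * B β β) := by
      rw [hmul, zero_mul]; linarith [mul_self_nonneg (B α β)]
    exact_mod_cast le_of_mul_le_mul_right this (mul_pos ha hb)
  rcases eq_or_ne n 0 with rfl | hn0
  · have : m = 0 := by
      have h0 : (m : ℚ) * B β β = 0 := by rw [← hm', hn']; simp
      exact_mod_cast (mul_eq_zero.mp h0).resolve_right hb.ne'
    simp [this]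
  · calc |m| ≤ |m| * |n| := le_mul_of_one_le_right (abs_nonneg _) (Int.one_le_abs hn0)
      _ = m * n := by rw [← abs_mul, abs_of_nonneg hge]
      _ ≤ 4 := hle

/-- A root in `W` is determined by its Cartan integers against a finite independent set of roots
spanning `Δ ∩ W`, and these integers take at most nine values each. -/
theorem finite_inter_of_integral (hs : B.IsSymm) (hp : ∀ x, x ≠ 0 → 0 < B x x) {Δ : Set V}
    (h0 : (0 : V) ∉ Δ) (hint : ∀ α ∈ Δ, ∀ β ∈ Δ, ∃ n : ℤ, cartan B α β = n)
    (W : Submodule ℚ V) [FiniteDimensional ℚ W] : (Δ ∩ (W : Set V)).Finite := by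
  obtain ⟨b, hbS, hspan, hli⟩ := exists_linearIndependent ℚ (Δ ∩ (W : Set V))
  have hbW : ∀ x : b, (x : V) ∈ W := fun x => (hbS x.2).2
  have hb : Finite b := by
    have : LinearIndependent ℚ (fun x : b => (⟨x, hbW x⟩ : W)) :=
      LinearIndependent.of_comp W.subtype hli
    exact this.finite
  choose! n hn using hint
  have hne : ∀ {x}, x ∈ Δ → x ≠ 0 := fun hx h => h0 (h ▸ hx)
  let f : V → b → ℤ := fun α x => n α x
  have hfin : (Set.univ.pi fun _ : b => Set.Icc (-4 : ℤ) 4).Finite :=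
    Set.Finite.pi fun _ => Set.finite_Icc _ _
  refine Set.Finite.of_finite_image (f := f) (hfin.subset ?_) ?_
  · rintro _ ⟨α, hα, rfl⟩ x -
    exact abs_le.mp (abs_le_four_of_cartan_eq hs hp (hne hα.1) (hne (hbS x.2).1)
      (hn _ hα.1 _ (hbS x.2).1) (hn _ (hbS x.2).1 _ hα.1))
  · intro α hα β hβ hf
    -- Equal Cartan integers make `α - β` orthogonal to `span b`, which contains `α - β` itself;
    -- definiteness then gives `α = β`.
    have hker : ∀ x ∈ Submodule.span ℚ b, x ∈ LinearMap.ker (B (α - β)) := by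
      rw [← SetLike.le_def, Submodule.span_le]
      intro x hx
      have hxΔ := (hbS hx).1
      have h1 := hn _ hα.1 _ hxΔ
      have h2 := hn _ hβ.1 _ hxΔ
      have h3 : n α x = n β x := congrFun hf ⟨x, hx⟩
      rw [h3, ← h2, cartan, cartan, div_left_inj' (hp x (hne hxΔ)).ne'] at h1
      simp only [SetLike.mem_coe, LinearMap.mem_ker, map_sub, LinearMap.sub_apply]
      linarith
    have hmem : α - β ∈ Submodule.span ℚ b := by
      rw [hspan]
      exact sub_mem (Submodule.subset_span hα) (Submodule.subset_span hβ)
    by_contra hne'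
    exact (hp _ (sub_ne_zero.mpr hne')).ne' (hker _ hmem)

theorem half_smul_mem_redPart {Δ : Set V} (hint : ∀ α ∈ Δ, ∀ β ∈ Δ, ∃ n : ℤ, cartan B α β = n)
    (han : ∀ α ∈ Δ, B α α ≠ 0) {μ : V} (hμ : μ ∈ Δ) (hr : μ ∉ redPart Δ) :
    (1 / 2 : ℚ) • μ ∈ redPart Δ := by
  have h2 : (1 / 2 : ℚ) • μ ∈ Δ := by
    by_contra h
    exact hr ⟨hμ, h⟩
  refine ⟨h2, fun h4 => ?_⟩
  obtain ⟨n, hn⟩ := hint _ h4 _ hμ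
  -- If `μ / 4` were also a root, its Cartan number against `μ` would be `1 / 2`, not an integer.
  have : cartan B ((1 / 2 : ℚ) • (1 / 2 : ℚ) • μ) μ = 1 / 2 := by
    have := han μ hμ
    simp only [cartan, map_smul, LinearMap.smul_apply, smul_eq_mul]
    field_simp
  rw [this] at hn
  have h : (1 : ℤ) = 2 * n := by
    have : (1 : ℚ) = 2 * n := by rw [← hn]; norm_num
    exact_mod_cast this
  omega

end Forms

/-! ### Reflectable sections: the splitting of `V`, the roots `Δ` and the group `G` -/

section Sections

variable {V : Type*} [AddCommGroup V] [Module ℚ V] {B : LinearMap.BilinForm ℚ V} {R : Set V}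
  {V' : Submodule ℚ V}

theorem IsReflectableSection.isCompl {hs : B.IsSymm} (h : IsReflectableSection B hs R V') :
    IsCompl V' (radical B) := by
  obtain ⟨P, dot, hP, hdot, rfl⟩ := h
  have himg : dot '' P = Set.range fun x : P => dot x := by
    ext; simp
  constructor
  · rw [himg]
    suffices h : LinearIndependent ℚ ((radical B).mkQ ∘ fun x : P => dot x) by
      simpa only [Submodule.ker_mkQ] using Submodule.range_ker_disjoint h
    have hfun : ((radical B).mkQ ∘ fun x : P => dot x) = ((↑) : P → V ⧸ radical B) :=
      funext fun x => (hdot x x.2).2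
    rw [hfun]
    exact hP.linearIndependent
  · have h := LinearMap.map_eq_top_iff (Submodule.range_mkQ (radical B))
      (p := Submodule.span ℚ (dot '' P))
    rw [Submodule.ker_mkQ] at h
    rw [codisjoint_iff, ← h, Submodule.map_span, Set.image_image, ← hP.span_eq_top]
    congr 1
    ext x
    constructor
    · rintro ⟨y, hy, rfl⟩
      beta_reduce
      rwa [(hdot y hy).2]
    · exact fun hx => ⟨x, hx, (hdot x hx).2⟩

theorem eq_of_mkQ_eq (hC : IsCompl V' (radical B)) {x y : V} (hx : x ∈ V') (hy : y ∈ V')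
    (h : (radical B).mkQ x = (radical B).mkQ y) : x = y := by
  rw [Submodule.mkQ_apply, Submodule.mkQ_apply, Submodule.Quotient.eq] at h
  exact sub_eq_zero.mp (Submodule.disjoint_def.mp hC.disjoint _ (sub_mem hx hy) h)

/-- The projection intertwines reflections, so a word in simple reflections lifts letter by letter.
It is applied with `S = R ∩ V'`. -/
theorem exists_mem_foldr_reflect (hs : B.IsSymm) {S : Set V}
    (hS : ∀ α ∈ S, ∀ β ∈ S, reflect B α β ∈ S) {P : Set (V ⧸ radical B)}
    {dot : V ⧸ radical B → V} (hdot : ∀ α ∈ P, dot α ∈ S ∧ (radical B).mkQ (dot α) = α)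
    {β : V ⧸ radical B} (hβ : β ∈ P) (l : List (V ⧸ radical B)) (hl : ∀ a ∈ l, a ∈ P) :
    ∃ γ ∈ S, (radical B).mkQ γ = l.foldr (reflect (inducedForm B hs)) β := by
  refine ⟨(l.map dot).foldr (reflect B) (dot β), foldr_reflect_mem hS (hdot β hβ).1 _ ?_, ?_⟩
  · intro a ha
    obtain ⟨c, hc, rfl⟩ := List.mem_map.mp ha
    exact (hdot c (hl c hc)).1
  · induction l with
    | nil => exact (hdot β hβ).2
    | cons a l ih =>
      rw [List.map_cons, List.foldr_cons, List.foldr_cons, mkQ_reflect hs,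
        ih fun b hb => hl b (by simp [hb]), (hdot a (hl a (by simp))).2]

theorem mem_of_mem_redPart_sectionRoots (hR : IsLEARS B R)
    (h : IsReflectableSection B hR.symm R V') {μ : V'} (hμ : μ ∈ redPart (sectionRoots B R V')) :
    (μ : V) ∈ R := by
  have hC := h.isCompl
  obtain ⟨P, dot, hP, hdot, hV'⟩ := h
  have hred : (radical B).mkQ (μ : V) ∈ redPart (imageBar B R) := by
    refine ⟨hμ.1, fun h2 => hμ.2 ?_⟩
    rw [← map_smul] at h2
    exact h2
  obtain ⟨l, hl, β, hβ, he⟩ := hP.exists_reflect _ hred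
  have hS : ∀ α ∈ R ∩ V', ∀ β ∈ R ∩ V', reflect B α β ∈ R ∩ V' := fun α hα β hβ =>
    ⟨hR.reflect_mem _ hα.1 _ hβ.1, sub_mem hβ.2 (Submodule.smul_mem _ _ hα.2)⟩
  obtain ⟨γ, hγ, hγe⟩ := exists_mem_foldr_reflect hR.symm hS (P := P) (dot := dot)
    (fun α hα => ⟨⟨(hdot α hα).1, hV' ▸ Submodule.subset_span (Set.mem_image_of_mem _ hα)⟩,
      (hdot α hα).2⟩) hβ l hl
  rw [eq_of_mkQ_eq hC μ.2 hγ.2 (he.trans hγe.symm)]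
  exact hγ.1

theorem mem_sectionRoots_iff {μ : V'} :
    μ ∈ sectionRoots B R V' ↔ ∃ g ∈ radical B, (μ : V) + g ∈ R := by
  constructor
  · rintro ⟨α, hα, h⟩
    rw [Submodule.mkQ_apply, Submodule.mkQ_apply, Submodule.Quotient.eq] at h
    exact ⟨α - μ, h, by simpa using hα⟩
  · rintro ⟨g, hg, h⟩
    refine ⟨_, h, ?_⟩
    rw [Submodule.mkQ_apply, Submodule.mkQ_apply, Submodule.Quotient.eq]
    simpa using hg

theorem mem_sectionGroup {μ : V'} {g : V} (hg : g ∈ radical B) (h : (μ : V) + g ∈ R) :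
    g ∈ sectionGroup B R V' :=
  AddSubgroup.subset_closure
    (Set.mem_biUnion (mem_sectionRoots_iff.mpr ⟨g, hg, h⟩) ⟨hg, h⟩)

theorem sectionGroup_le_radical : sectionGroup B R V' ≤ (radical B).toAddSubgroup := by
  rw [sectionGroup, AddSubgroup.closure_le]
  exact Set.iUnion₂_subset fun _ _ _ hv => hv.1

theorem sectionGroup_closure_eq_top_of_forall_mem {S : Set (sectionGroup B R V')}
    (hS : ∀ (μ : V') (g : sectionGroup B R V'),
      μ ∈ sectionRoots B R V' ∧ (μ : V) + g ∈ R → g ∈ S) :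
    AddSubgroup.closure S = ⊤ := by
  have hle : sectionGroup B R V' ≤
      (AddSubgroup.closure S).map (sectionGroup B R V').subtype := by
    refine (AddSubgroup.closure_le _).mpr (Set.iUnion₂_subset fun μ hμ g hg => ?_)
    have hg' := mem_sectionGroup hg.1 hg.2
    exact ⟨⟨g, hg'⟩, AddSubgroup.subset_closure (hS μ ⟨g, hg'⟩ ⟨hμ, hg.2⟩), rfl⟩
  rw [eq_top_iff]
  rintro g -
  obtain ⟨k, hk, he⟩ := hle g.2
  rwa [← Subtype.ext he]

theorem exists_add_eq_of_mem (hC : IsCompl V' (radical B)) {α : V} (hα : α ∈ R) :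
    ∃ μ ∈ sectionRoots B R V', ∃ g : sectionGroup B R V', (μ : V) + g = α := by
  obtain ⟨μ, hμ, g, hg, rfl⟩ : ∃ μ ∈ V', ∃ g ∈ radical B, μ + g = α :=
    Submodule.mem_sup.mp (hC.sup_eq_top ▸ Submodule.mem_top)
  exact ⟨⟨μ, hμ⟩, mem_sectionRoots_iff.mpr ⟨g, hg, hα⟩,
    ⟨g, mem_sectionGroup (μ := ⟨μ, hμ⟩) hg hα⟩, rfl⟩

theorem eq_and_eq_of_add_eq_add (hC : IsCompl V' (radical B)) {μ ν : V'}
    {g h : sectionGroup B R V'} (he : (μ : V) + g = ν + h) : μ = ν ∧ g = h := by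
  have hμ : μ = ν := by
    refine Subtype.ext (eq_of_mkQ_eq hC μ.2 ν.2 ?_)
    rw [Submodule.mkQ_apply, Submodule.mkQ_apply, Submodule.Quotient.eq]
    have : (μ : V) - ν = h - g := by
      rw [sub_eq_sub_iff_add_eq_add, he, add_comm]
    rw [this]
    exact sub_mem (sectionGroup_le_radical h.2) (sectionGroup_le_radical g.2)
  subst hμ
  exact ⟨rfl, Subtype.ext (add_left_cancel he)⟩

theorem exists_add_eq_of_mem_rootLattice (hC : IsCompl V' (radical B)) {ξ : V}
    (hξ : ξ ∈ rootLattice R) :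
    ∃ μ ∈ AddSubgroup.closure (sectionRoots B R V'), ∃ g : sectionGroup B R V',
      (μ : V) + g = ξ := by
  induction hξ using AddSubgroup.closure_induction with
  | mem α hα =>
    obtain ⟨μ, hμ, g, h⟩ := exists_add_eq_of_mem hC hα
    exact ⟨μ, AddSubgroup.subset_closure hμ, g, h⟩
  | zero => exact ⟨0, zero_mem _, 0, by simp⟩
  | add x y _ _ hx hy =>
    obtain ⟨μ, hμ, g, rfl⟩ := hx
    obtain ⟨ν, hν, h, rfl⟩ := hy
    exact ⟨μ + ν, add_mem hμ hν, g + h, by push_cast; abel⟩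
  | neg x _ hx =>
    obtain ⟨μ, hμ, g, rfl⟩ := hx
    exact ⟨-μ, neg_mem hμ, -g, by push_cast; abel⟩

theorem existsUnique_add_eq_of_mem_rootLattice (hC : IsCompl V' (radical B)) {ξ : V}
    (hξ : ξ ∈ rootLattice R) :
    ∃! p : V' × sectionGroup B R V',
      p.1 ∈ AddSubgroup.closure (sectionRoots B R V') ∧ (p.1 : V) + (p.2 : V) = ξ := by
  obtain ⟨μ, hμ, g, h⟩ := exists_add_eq_of_mem_rootLattice hC hξ
  refine ⟨(μ, g), ⟨hμ, h⟩, ?_⟩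
  rintro ⟨ν, k⟩ ⟨-, hk⟩
  obtain ⟨rfl, rfl⟩ := eq_and_eq_of_add_eq_add hC (hk.trans h.symm)
  rfl

theorem anisotropic_sectionRoots (hR : IsLEARS B R) {μ : V'} (hμ : μ ∈ sectionRoots B R V') :
    B (μ : V) μ ≠ 0 := by
  obtain ⟨g, hg, h⟩ := mem_sectionRoots_iff.mp hμ
  rw [← apply_add_add_of_mem_radical hR.symm hg hg]
  exact hR.anisotropic _ h

theorem integral_sectionRoots (hR : IsLEARS B R) {μ ν : V'} (hμ : μ ∈ sectionRoots B R V')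
    (hν : ν ∈ sectionRoots B R V') : ∃ n : ℤ, cartan (B.restrict V') μ ν = n := by
  obtain ⟨g, hg, hμg⟩ := mem_sectionRoots_iff.mp hμ
  obtain ⟨h, hh, hνh⟩ := mem_sectionRoots_iff.mp hν
  obtain ⟨n, hn⟩ := hR.integral _ hμg _ hνh
  rw [cartan_add_add_of_mem_radical hR.symm hg hh] at hn
  exact ⟨n, hn⟩

/-- The form is definite on `V'` because isotropic vectors lie in the radical; the remaining axioms
pass from `R` to `Δ` modulo the radical. -/
theorem isLocallyFiniteIrreducibleRootSystem_sectionRoots (hR : IsLEARS B R)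
    (hC : IsCompl V' (radical B)) :
    IsLocallyFiniteIrreducibleRootSystem (B.restrict V') (sectionRoots B R V') := by
  have hsymm : (B.restrict V').IsSymm := ⟨fun x y => hR.symm.eq x y⟩
  have hpos : ∀ x : V', x ≠ 0 → 0 < B.restrict V' x x := fun x hx => by
    refine lt_of_le_of_ne (hR.nonneg x) fun h => hx (Subtype.ext ?_)
    exact Submodule.disjoint_def.mp hC.disjoint _ x.2
      (mem_radical_of_apply_self hR.symm hR.nonneg h.symm)
  have hzero : (0 : V') ∉ sectionRoots B R V' := fun h =>
    anisotropic_sectionRoots hR h (by simp)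
  refine ⟨hsymm, hpos, hzero, ?_, ?_, fun _ hα _ hβ => integral_sectionRoots hR hα hβ, ?_, ?_⟩
  · rw [eq_top_iff]
    rintro x -
    have key : ∀ v ∈ Submodule.span ℚ R, ∃ y ∈ Submodule.span ℚ (sectionRoots B R V'),
        v - (y : V) ∈ radical B := by
      intro v hv
      induction hv using Submodule.span_induction with
      | mem α hα =>
        obtain ⟨μ, hμ, g, rfl⟩ := exists_add_eq_of_mem hC hα
        exact ⟨μ, Submodule.subset_span hμ, by simpa using sectionGroup_le_radical g.2⟩
      | zero => exact ⟨0, zero_mem _, by simp⟩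
      | add u w _ _ hu hw =>
        obtain ⟨y, hy, hy'⟩ := hu
        obtain ⟨z, hz, hz'⟩ := hw
        refine ⟨y + z, add_mem hy hz, ?_⟩
        rw [Submodule.coe_add, add_sub_add_comm]
        exact add_mem hy' hz'
      | smul c u _ hu =>
        obtain ⟨y, hy, hy'⟩ := hu
        refine ⟨c • y, Submodule.smul_mem _ _ hy, ?_⟩
        rw [Submodule.coe_smul, ← smul_sub]
        exact Submodule.smul_mem _ _ hy'
    obtain ⟨y, hy, hxy⟩ := key x (hR.span_eq_top ▸ Submodule.mem_top)
    have : x = y := Subtype.ext (sub_eq_zero.mp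
      (Submodule.disjoint_def.mp hC.disjoint _ (sub_mem x.2 y.2) hxy))
    rwa [this]
  · intro W hW
    exact finite_inter_of_integral hsymm hpos hzero
      (fun _ hα _ hβ => integral_sectionRoots hR hα hβ) W
  · intro μ hμ ν hν
    obtain ⟨g, hg, hμg⟩ := mem_sectionRoots_iff.mp hμ
    obtain ⟨h, hh, hνh⟩ := mem_sectionRoots_iff.mp hν
    refine ⟨_, hR.reflect_mem _ hμg _ hνh, ?_⟩
    rw [Submodule.mkQ_apply, Submodule.mkQ_apply, Submodule.Quotient.eq, reflect,
      cartan_add_add_of_mem_radical hR.symm hh hg]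
    have : ν + h - cartan B (ν : V) μ • ((μ : V) + g) -
        (reflect (B.restrict V') μ ν : V') = h - cartan B (ν : V) μ • g := by
      change ν + h - cartan B (ν : V) μ • ((μ : V) + g) - (ν - cartan B (ν : V) μ • (μ : V)) = _
      rw [smul_add]; abel
    rw [this]
    exact sub_mem hh (Submodule.smul_mem _ _ hg)
  · intro Δ₁ Δ₂ hΔ horth
    -- The roots of `R` lying over a subset of `Δ`: an orthogonal splitting of `Δ` lifts to one of
    -- `R`.
    let T : Set V' → Set V := fun Δ => {α | α ∈ R ∧ ∃ μ ∈ Δ, ∃ g ∈ radical B, (μ : V) + g = α}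
    have hT : ∀ Δ ⊆ sectionRoots B R V', T Δ = ∅ → Δ = ∅ := by
      intro Δ hsub hemp
      rw [Set.eq_empty_iff_forall_notMem] at hemp ⊢
      intro μ hμ
      obtain ⟨g, hg, h⟩ := mem_sectionRoots_iff.mp (hsub hμ)
      exact hemp _ ⟨h, μ, hμ, g, hg, rfl⟩
    have hu : R = T Δ₁ ∪ T Δ₂ := by
      ext α
      constructor
      · intro hα
        obtain ⟨μ, hμ, g, h⟩ := exists_add_eq_of_mem hC hα
        rw [hΔ] at hμ
        exact hμ.imp (fun hμ => ⟨hα, μ, hμ, g, sectionGroup_le_radical g.2, h⟩)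
          (fun hμ => ⟨hα, μ, hμ, g, sectionGroup_le_radical g.2, h⟩)
      · rintro (h | h) <;> exact h.1
    refine (hR.irreducible _ _ hu ?_).imp (hT _ (hΔ ▸ Set.subset_union_left))
      (hT _ (hΔ ▸ Set.subset_union_right))
    rintro _ ⟨-, μ, hμ, g, hg, rfl⟩ _ ⟨-, ν, hν, h, hh, rfl⟩
    rw [apply_add_add_of_mem_radical hR.symm hg hh]
    exact horth μ hμ ν hν

theorem sectionRoots_subset_rootLattice (hR : IsLEARS B R)
    (h : IsReflectableSection B hR.symm R V') {μ : V'} (hμ : μ ∈ sectionRoots B R V') :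
    (μ : V) ∈ rootLattice R := by
  by_cases hr : μ ∈ redPart (sectionRoots B R V')
  · exact AddSubgroup.subset_closure (mem_of_mem_redPart_sectionRoots hR h hr)
  · have h2 := AddSubgroup.subset_closure (mem_of_mem_redPart_sectionRoots hR h
      (half_smul_mem_redPart (B := B.restrict V') (fun _ hα _ hβ => integral_sectionRoots hR hα hβ)
        (fun _ hα => anisotropic_sectionRoots hR hα) hμ hr))
    have h3 := add_mem h2 h2
    rwa [Submodule.coe_smul, ← add_smul, add_halves, one_smul] at h3

theorem sectionGroup_le_rootLattice (hR : IsLEARS B R)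
    (h : IsReflectableSection B hR.symm R V') : sectionGroup B R V' ≤ rootLattice R := by
  rw [sectionGroup, AddSubgroup.closure_le]
  refine Set.iUnion₂_subset fun μ hμ g hg => ?_
  simpa using sub_mem (AddSubgroup.subset_closure hg.2 : (μ : V) + g ∈ rootLattice R)
    (sectionRoots_subset_rootLattice hR h hμ)

theorem add_mem_rootLattice (hR : IsLEARS B R) (h : IsReflectableSection B hR.symm R V')
    {μ : V'} (hμ : μ ∈ sectionRoots B R V' ∪ {0}) (g : sectionGroup B R V') :
    (μ : V) + g ∈ rootLattice R := by
  refine add_mem ?_ (sectionGroup_le_rootLattice hR h g.2)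
  rcases hμ with hμ | rfl
  · exact sectionRoots_subset_rootLattice hR h hμ
  · exact zero_mem _

end Sections

/-! ### From the `Q`-grading to the double grading -/

section Tori

variable {F : Type*} [Field F] {L : Type*} [LieRing L] [LieAlgebra F L]
  {V : Type*} [AddCommGroup V] [Module ℚ V] {B : LinearMap.BilinForm ℚ V} {R : Set V}
  {V' : Submodule ℚ V} {𝓖 : rootLattice R → Submodule F L}

/-- The span of the brackets `[L_α, L_{ξ-α}]`, `α ∈ R`. -/
def rootBrackets (𝓖 : rootLattice R → Submodule F L) (ξ : rootLattice R) : Submodule F L :=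
  Submodule.span F {z | ∃ α : rootLattice R, (α : V) ∈ R ∧ ∃ x ∈ 𝓖 α, ∃ y ∈ 𝓖 (ξ - α), ⁅x, y⁆ = z}

theorem IsLieRTorus.mem_of_ne_bot (h : IsLieRTorus B R 𝓖) {ξ : rootLattice R} (hξ : 𝓖 ξ ≠ ⊥)
    (hB : B (ξ : V) ξ ≠ 0) : (ξ : V) ∈ R :=
  h.supp_eq.subset ⟨ξ, rfl, hξ, hB⟩

theorem IsLieRTorus.ne_bot (h : IsLieRTorus B R 𝓖) {ξ : rootLattice R} (hξ : (ξ : V) ∈ R) :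
    𝓖 ξ ≠ ⊥ := by
  obtain ⟨η, he, hη, -⟩ := h.supp_eq.superset hξ
  rwa [← Subtype.ext he]

theorem IsLieRTorus.le_rootBrackets (h : IsLieRTorus B R 𝓖) (hR : IsLEARS B R)
    {ξ : rootLattice R} (hξ : B (ξ : V) ξ = 0) : 𝓖 ξ ≤ rootBrackets 𝓖 ξ := by
  classical
  -- The anisotropic components are kept, and the isotropic ones are cut down to root brackets.
  let N : rootLattice R → Submodule F L := fun η =>
    if B (η : V) η = 0 then rootBrackets 𝓖 η else 𝓖 η
  have hNle : N ≤ 𝓖 := by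
    intro η
    dsimp only [N]
    split_ifs
    · refine Submodule.span_le.mpr ?_
      rintro _ ⟨α, -, x, hx, y, hy, rfl⟩
      simpa using h.lie_mem _ _ x hx y hy
    · exact le_rfl
  have hroot : ∀ {α : rootLattice R}, (α : V) ∈ R → 𝓖 α ≤ ⨆ η, N η := by
    intro α hα
    refine le_trans (le_of_eq ?_) (le_iSup N α)
    exact (if_neg (hR.anisotropic _ hα)).symm
  -- Bracketing with a root vector lands either in an anisotropic degree, where nothing was removed,
  -- or in an isotropic one, where the result is a root bracket by definition.
  have hlie : ∀ {α : rootLattice R}, (α : V) ∈ R → ∀ x ∈ 𝓖 α, ∀ m ∈ ⨆ η, N η,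
      ⁅x, m⁆ ∈ ⨆ η, N η := by
    intro α hα x hx m hm
    induction hm using Submodule.iSup_induction' with
    | mem η m hm =>
      refine le_iSup N (α + η) ?_
      dsimp only [N]
      split_ifs
      · exact Submodule.subset_span ⟨α, hα, x, hx, m, by simpa using hNle η hm, rfl⟩
      · exact h.lie_mem _ _ x hx m (hNle η hm)
    | zero => simp
    | add a b _ _ ha hb => rw [lie_add]; exact add_mem ha hb
  have hgen : ∀ x : L, x ∈ LieSubalgebra.lieSpan F L
      (⋃ ξ ∈ {ξ : rootLattice R | (ξ : V) ∈ R}, (𝓖 ξ : Set L)) := fun x => by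
    rw [h.generated]; exact LieSubalgebra.mem_top x
  have hideal : ∀ x : L, ∀ m ∈ ⨆ η, N η, ⁅x, m⁆ ∈ ⨆ η, N η := by
    intro x
    induction hgen x using LieSubalgebra.lieSpan_induction with
    | mem x hx =>
      obtain ⟨α, hα, hx⟩ := Set.mem_iUnion₂.mp hx
      exact hlie hα x hx
    | zero => simp
    | add a b _ _ ha hb => intro m hm; rw [add_lie]; exact add_mem (ha m hm) (hb m hm)
    | smul c a _ ha => intro m hm; rw [smul_lie]; exact Submodule.smul_mem _ _ (ha m hm)
    | lie a b _ _ ha hb =>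
      intro m hm
      rw [lie_lie]
      exact sub_mem (ha _ (hb m hm)) (hb _ (ha m hm))
  have htop : ⨆ η, N η = ⊤ := by
    rw [eq_top_iff]
    rintro x -
    induction hgen x using LieSubalgebra.lieSpan_induction with
    | mem x hx =>
      obtain ⟨α, hα, hx⟩ := Set.mem_iUnion₂.mp hx
      exact hroot hα hx
    | zero => exact zero_mem _
    | add a b _ _ ha hb => exact add_mem ha hb
    | smul c a _ ha => exact Submodule.smul_mem _ _ ha
    | lie a b _ _ _ hb => exact hideal a b hb
  have hind := ((DirectSum.isInternal_submodule_iff_iSupIndep_and_iSup_eq_top _).mp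
    h.isInternal).1
  -- In an independent family, subspaces of the components that still span everything must be the
  -- whole components.
  have hNe : N = 𝓖 := (hind.le_iff_eq_of_iSup_eq_top htop).mp hNle
  rw [← congrFun hNe ξ]
  exact le_of_eq (if_pos hξ)

theorem sectionGrading_eq {μ : V'} {g : sectionGroup B R V'}
    (h : (μ : V) + g ∈ rootLattice R) : sectionGrading B R V' 𝓖 μ g = 𝓖 ⟨_, h⟩ :=
  dif_pos h

theorem sectionGrading_of_eq {μ : V'} {g : sectionGroup B R V'} {ξ : rootLattice R}
    (h : (μ : V) + g = ξ) : sectionGrading B R V' 𝓖 μ g = 𝓖 ξ := by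
  have h' : (μ : V) + g ∈ rootLattice R := h ▸ ξ.2
  rw [sectionGrading_eq h']
  congr 1
  exact Subtype.ext h

theorem IsLieRTorus.exists_add_eq_of_ne_bot (h : IsLieRTorus B R 𝓖) (hR : IsLEARS B R)
    (hC : IsCompl V' (radical B)) {ξ : rootLattice R} (hξ : 𝓖 ξ ≠ ⊥) :
    ∃ μ ∈ sectionRoots B R V' ∪ {0}, ∃ g : sectionGroup B R V', (μ : V) + g = ξ := by
  by_cases hB : B (ξ : V) ξ = 0
  · obtain ⟨μ, -, g, he⟩ := exists_add_eq_of_mem_rootLattice hC ξ.2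
    have hrad := mem_radical_of_apply_self hR.symm hR.nonneg hB
    have hμ : (μ : V) ∈ radical B := by
      rw [eq_sub_of_add_eq he]
      exact sub_mem hrad (sectionGroup_le_radical g.2)
    exact ⟨μ, Or.inr (Subtype.ext (Submodule.disjoint_def.mp hC.disjoint _ μ.2 hμ)), g, he⟩
  · obtain ⟨μ, hμ, g, he⟩ := exists_add_eq_of_mem hC (h.mem_of_ne_bot hξ hB)
    exact ⟨μ, Or.inl hμ, g, he⟩

theorem IsLieRTorus.isInternal_sectionGrading (h : IsLieRTorus B R 𝓖) (hR : IsLEARS B R)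
    (hV' : IsReflectableSection B hR.symm R V')
    {_ : DecidableEq ({μ : V' // μ ∈ sectionRoots B R V' ∪ {0}} × sectionGroup B R V')} :
    DirectSum.IsInternal (fun p : {μ : V' // μ ∈ sectionRoots B R V' ∪ {0}} × sectionGroup B R V' =>
      sectionGrading B R V' 𝓖 (p.1 : V') p.2) := by
  classical
  have hC := hV'.isCompl
  -- Landing in `Q` uses `Δ ⊆ Q` and `G ⊆ Q`, so the default value `⊥` of `sectionGrading` never
  -- occurs for these indices.
  let f : {μ : V' // μ ∈ sectionRoots B R V' ∪ {0}} × sectionGroup B R V' → rootLattice R :=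
    fun p => ⟨_, add_mem_rootLattice hR hV' p.1.2 p.2⟩
  have hf : Function.Injective f := by
    rintro ⟨⟨μ, hμ⟩, g⟩ ⟨⟨ν, hν⟩, k⟩ he
    obtain ⟨rfl, rfl⟩ := eq_and_eq_of_add_eq_add hC (congrArg Subtype.val he)
    rfl
  have hfun : (fun p : {μ : V' // μ ∈ sectionRoots B R V' ∪ {0}} × sectionGroup B R V' =>
      sectionGrading B R V' 𝓖 (p.1 : V') p.2) = 𝓖 ∘ f := by
    funext p
    exact sectionGrading_eq _
  obtain ⟨hind, htop⟩ := (DirectSum.isInternal_submodule_iff_iSupIndep_and_iSup_eq_top _).mp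
    h.isInternal
  rw [DirectSum.isInternal_submodule_iff_iSupIndep_and_iSup_eq_top, hfun]
  refine ⟨hind.comp hf, ?_⟩
  rw [eq_top_iff, ← htop]
  refine iSup_le fun ξ => ?_
  by_cases hξ : 𝓖 ξ = ⊥
  · rw [hξ]; exact bot_le
  · obtain ⟨μ, hμ, g, he⟩ := h.exists_add_eq_of_ne_bot hR hC hξ
    have : f (⟨μ, hμ⟩, g) = ξ := Subtype.ext he
    rw [← this]
    exact le_iSup (𝓖 ∘ f) (⟨μ, hμ⟩, g)

theorem IsLieRTorus.add_mem_of_sectionGrading_ne_bot (h : IsLieRTorus B R 𝓖) (hR : IsLEARS B R)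
    {μ : V'} (hμ : μ ∈ sectionRoots B R V') {g : sectionGroup B R V'}
    (hne : sectionGrading B R V' 𝓖 μ g ≠ ⊥) : (μ : V) + g ∈ R := by
  by_cases hQ : (μ : V) + g ∈ rootLattice R
  · rw [sectionGrading_eq hQ] at hne
    refine h.mem_of_ne_bot hne ?_
    have hg := sectionGroup_le_radical g.2
    change B ((μ : V) + g) (μ + g) ≠ 0
    rw [apply_add_add_of_mem_radical hR.symm hg hg]
    exact anisotropic_sectionRoots hR hμ
  · exact absurd (dif_neg hQ) hne

theorem IsLieRTorus.lie_mem_sectionGrading (h : IsLieRTorus B R 𝓖) (μ ν : V') (g k : sectionGroup B R V')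
    {x y : L} (hx : x ∈ sectionGrading B R V' 𝓖 μ g) (hy : y ∈ sectionGrading B R V' 𝓖 ν k) :
    ⁅x, y⁆ ∈ sectionGrading B R V' 𝓖 (μ + ν) (g + k) := by
  by_cases h1 : (μ : V) + g ∈ rootLattice R
  · by_cases h2 : (ν : V) + k ∈ rootLattice R
    · rw [sectionGrading_eq h1] at hx
      rw [sectionGrading_eq h2] at hy
      rw [sectionGrading_of_eq (ξ := ⟨_, h1⟩ + ⟨_, h2⟩) (by push_cast; abel)]
      exact h.lie_mem _ _ x hx y hy
    · rw [sectionGrading, dif_neg h2, Submodule.mem_bot] at hy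
      rw [hy, lie_zero]
      exact zero_mem _
  · rw [sectionGrading, dif_neg h1, Submodule.mem_bot] at hx
    rw [hx, zero_lie]
    exact zero_mem _

theorem IsLieRTorus.sectionGrading_zero (h : IsLieRTorus B R 𝓖) (hR : IsLEARS B R)
    (hV' : IsReflectableSection B hR.symm R V') (g : sectionGroup B R V') :
    sectionGrading B R V' 𝓖 0 g = ⨆ μ ∈ sectionRoots B R V', ⨆ k : sectionGroup B R V',
      Submodule.span F {z : L | ∃ x ∈ sectionGrading B R V' 𝓖 μ k,
        ∃ y ∈ sectionGrading B R V' 𝓖 (-μ) (g - k), ⁅x, y⁆ = z} := by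
  apply le_antisymm
  · have hQ : (g : V) ∈ rootLattice R := sectionGroup_le_rootLattice hR hV' g.2
    rw [sectionGrading_of_eq (ξ := ⟨(g : V), hQ⟩) (by simp)]
    refine (h.le_rootBrackets hR
      (apply_eq_zero_of_mem_radical (sectionGroup_le_radical g.2) _)).trans ?_
    refine Submodule.span_le.mpr ?_
    rintro _ ⟨α, hα, x, hx, y, hy, rfl⟩
    obtain ⟨μ, hμ, k, he⟩ := exists_add_eq_of_mem hV'.isCompl hα
    refine Submodule.mem_iSup_of_mem μ (Submodule.mem_iSup_of_mem hμ
      (Submodule.mem_iSup_of_mem k (Submodule.subset_span ⟨x, ?_, y, ?_, rfl⟩)))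
    · rwa [sectionGrading_of_eq he]
    · rwa [sectionGrading_of_eq (ξ := ⟨(g : V), hQ⟩ - α) (by push_cast; rw [← he]; abel)]
  · refine iSup₂_le fun μ _ => iSup_le fun k => Submodule.span_le.mpr ?_
    rintro _ ⟨x, hx, y, hy, rfl⟩
    simpa using h.lie_mem_sectionGrading _ _ _ _ hx hy

theorem IsLieRTorus.rank_sectionGrading (h : IsLieRTorus B R 𝓖) {μ : V'}
    {g : sectionGroup B R V'} (hα : (μ : V) + g ∈ R) :
    Module.rank F (sectionGrading B R V' 𝓖 μ g) = 1 := by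
  rw [sectionGrading_eq (AddSubgroup.subset_closure hα)]
  exact h.rank_eq_one _ hα

theorem IsLieRTorus.sectionGrading_ne_bot (h : IsLieRTorus B R 𝓖) {μ : V'}
    {g : sectionGroup B R V'} (hα : (μ : V) + g ∈ R) : sectionGrading B R V' 𝓖 μ g ≠ ⊥ := by
  rw [sectionGrading_eq (AddSubgroup.subset_closure hα)]
  exact h.ne_bot hα

theorem IsLieRTorus.division_sectionGrading (h : IsLieRTorus B R 𝓖) (hR : IsLEARS B R)
    {μ : V'} (hμ : μ ∈ sectionRoots B R V') (g : sectionGroup B R V')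
    {x : L} (hx : x ∈ sectionGrading B R V' 𝓖 μ g) (hx0 : x ≠ 0) :
    ∃ y ∈ sectionGrading B R V' 𝓖 (-μ) (-g), ⁅x, y⁆ ∈ sectionGrading B R V' 𝓖 0 0 ∧
      ∀ (ν : V') (k : sectionGroup B R V'), ∀ z ∈ sectionGrading B R V' 𝓖 ν k,
        ⁅⁅x, y⁆, z⁆ = ((cartan (B.restrict V') ν μ : ℚ) : F) • z := by
  -- A nonzero vector in this anisotropic degree forces the degree to be a root, so the division
  -- property of the `R`-torus applies.
  have hα : (μ : V) + g ∈ R := h.add_mem_of_sectionGrading_ne_bot hR hμ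
    fun hb => hx0 (by rwa [hb, Submodule.mem_bot] at hx)
  have hQ := AddSubgroup.subset_closure hα
  rw [sectionGrading_eq hQ] at hx
  obtain ⟨y, hy, hxy, hact⟩ := h.division ⟨_, hQ⟩ hα x hx hx0
  refine ⟨y, ?_, ?_, fun ν k z hz => ?_⟩
  · rwa [sectionGrading_of_eq (ξ := -⟨_, hQ⟩) (by push_cast; abel)]
  · rwa [sectionGrading_of_eq (ξ := 0) (by simp)]
  · by_cases hk : (ν : V) + k ∈ rootLattice R
    · rw [sectionGrading_eq hk] at hz
      rw [hact _ z hz, cartan_add_add_of_mem_radical hR.symm (sectionGroup_le_radical k.2)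
        (sectionGroup_le_radical g.2)]
      rfl
    · rw [sectionGrading, dif_neg hk, Submodule.mem_bot] at hz
      simp [hz]

theorem IsLieRTorus.isNormalLieTorus (h : IsLieRTorus B R 𝓖) (hR : IsLEARS B R)
    (hV' : IsReflectableSection B hR.symm R V') :
    IsNormalLieTorus (B.restrict V') (sectionRoots B R V') (sectionGrading B R V' 𝓖) where
  rootSystem := isLocallyFiniteIrreducibleRootSystem_sectionRoots hR hV'.isCompl
  isInternal := h.isInternal_sectionGrading hR hV'
  lie_mem _ _ _ _ _ _ _ _ hx _ hy := h.lie_mem_sectionGrading _ _ _ _ hx hy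
  zero_part := h.sectionGrading_zero hR hV'
  division μ hμ g x hx hx0 := by
    obtain ⟨y, hy, hxy, hact⟩ := h.division_sectionGrading hR hμ g hx hx0
    exact ⟨y, hy, hxy, fun ν _ => hact ν⟩
  supp_generates := by
    exact sectionGroup_closure_eq_top_of_forall_mem fun μ g hα =>
      ⟨μ, Or.inl hα.1, h.sectionGrading_ne_bot hα.2⟩
  rank_le_one μ hμ g := by
    by_cases hne : sectionGrading B R V' 𝓖 μ g = ⊥
    · rw [hne, rank_subsingleton']
      exact zero_le_one
    · exact (h.rank_sectionGrading (h.add_mem_of_sectionGrading_ne_bot hR hμ hne)).le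
  root_ne_bot μ hμ := by
    obtain ⟨g, hg, hα⟩ := mem_sectionRoots_iff.mp hμ
    exact ne_bot_of_le_ne_bot (h.sectionGrading_ne_bot (g := ⟨g, mem_sectionGroup hg hα⟩) hα)
      (le_iSup _ _)
  rank_zero_eq_one μ hμ := h.rank_sectionGrading
    (by simpa using mem_of_mem_redPart_sectionRoots hR hV' hμ)

end Tori

end LieTori

theorem mainTheorem9 {F : Type*} [Field F] [CharZero F]
    {V : Type*} [AddCommGroup V] [Module ℚ V]
    (B : LinearMap.BilinForm ℚ V) (R : Set V) (hR : LieTori.IsLEARS B R)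
    (V' : Submodule ℚ V) (hV' : LieTori.IsReflectableSection B hR.symm R V') :
    IsCompl V' (LieTori.radical B) ∧
    (∀ α ∈ LieTori.redPart (LieTori.sectionRoots B R V'), (α : V) ∈ R) ∧
    (∀ ξ ∈ LieTori.rootLattice R, ∃! p : V' × LieTori.sectionGroup B R V',
      p.1 ∈ AddSubgroup.closure (LieTori.sectionRoots B R V') ∧ (p.1 : V) + (p.2 : V) = ξ) ∧
    ∀ {L : Type*} [LieRing L] [LieAlgebra F L]
      (𝓖 : LieTori.rootLattice R → Submodule F L), LieTori.IsLieRTorus B R 𝓖 →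
      LieTori.IsNormalLieTorus (B.restrict V') (LieTori.sectionRoots B R V')
        (LieTori.sectionGrading B R V' 𝓖) := by
  exact ⟨hV'.isCompl, fun _ hα => LieTori.mem_of_mem_redPart_sectionRoots hR hV' hα,
    fun _ hξ => LieTori.existsUnique_add_eq_of_mem_rootLattice hV'.isCompl hξ,
    fun _ h => h.isNormalLieTorus hR hV'⟩
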